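/- **The camel–banana problem.** The desert is a real line (unit: one mile) with its border at the origin, extending in the positive direction. A camel with empty stomach and $N\ge 0$ bananas start at the origin. The camel can carry at most one banana at a time on its back, can have at most one banana at a time in its stomach (so it eats only when its stomach is empty), and walks at most one mile on each banana eaten; without a banana in its stomach it cannot walk. It may put a carried banana down at its position, and pick up (if it carries none) or eat a banana lying at its position. A *strategy* for $N$ bananas is a finite sequence of straight walks (in either direction), pick-ups, put-downs and meals that obeys these rules. The distance that a strategy reaches is the largest coordinate that the camel visits. **The UWC-strategy.** Repeat the following step until no bananas are left. In each step the camel is with the banana(s) closest to the origin. 1. If the number of bananas left is even: eat a banana, carry another banana from there as far as possible, and return to the banana(s) closest to the origin. 2. If the number of bananas left is odd: eat a banana, carry another banana from there to the furthest banana, then carry both these bananas (each in turn, over the same distance) as far as possible, and finally return to the banana(s) closest to the origin. "As far as possible" means that the whole step uses just the one mile provided by the banana eaten in it. When $2$ or $3$ bananas are left, the step is done without returning; when $1$ banana is left, the camel eats it and walks one mile forward. Let $c(N)$ be the distance that the UWC-strategy reaches with $N$ bananas. **Theorem.** The UWC-strategy is optimal: for every $N$, the UWC-strategy is a strategy for $N$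 bananas (it obeys the rules), and no strategy for $N$ bananas reaches a distance greater than $c(N)$. -/

import Mathlib

/-! The camel-banana problem on the real line: positions are real numbers (unit: one mile),
the border of the desert is the origin and the desert extends in the positive direction. -/

namespace Camel

/-- A situation: the position of the camel, the number of miles it can still walk on the banana
in its stomach, whether there is a banana on its back, and the positions (with multiplicity)
of the bananas lying on the ground. -/
structure State where
  pos : ℝ
  fuel : ℝ
  loaded : Bool
  stock : Multiset ℝ

/-- The elementary actions: walk straight ahead over a signed distance `d`; take a banana lying at
the current position on the back; put the carried banana on the ground; eat a banana lying at
the current position. (A carried banana is eaten by putting it down first; a general walk is a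
finite succession of straight ones.) -/
inductive Action where
  | walk (d : ℝ)
  | pickUp
  | putDown
  | eat

/-- When an action is allowed. The camel carries at most one banana, has at most one banana in its
stomach (so it eats only when the stomach is empty), and walks at most one mile per banana. -/
def Allowed (s : State) : Action → Prop
  | .walk d => |d| ≤ s.fuel
  | .pickUp => s.loaded = false ∧ s.pos ∈ s.stock
  | .putDown => s.loaded = true
  | .eat => s.fuel = 0 ∧ s.pos ∈ s.stock

/-- The effect of an action. -/
noncomputable def act (s : State) : Action → State
  | .walk d => { s with pos := s.pos + d, fuel := s.fuel - |d| }
  | .pickUp => { s with loaded := true, stock := s.stock.erase s.pos }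
  | .putDown => { s with loaded := false, stock := s.pos ::ₘ s.stock }
  | .eat => { s with fuel := 1, stock := s.stock.erase s.pos }

/-- The situation after a list of actions. -/
noncomputable def run (s : State) : List Action → State
  | [] => s
  | a :: l => run (act s a) l

/-- Every action of the list is allowed at the moment it is performed. -/
def AllowedFrom (s : State) : List Action → Prop
  | [] => True
  | a :: l => Allowed s a ∧ AllowedFrom (act s a) l

/-- The largest coordinate the camel visits; as each walk is straight, it suffices to look at the
end points of the walks. -/
noncomputable def maxPos (s : State) : List Action → ℝ
  | [] => s.pos
  | a :: l => max s.pos (maxPos (act s a) l)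

/-- The initial situation: the camel, with empty stomach and empty back, and `N` bananas are at
the origin. -/
def start (N : ℕ) : State := ⟨0, 0, false, Multiset.replicate N 0⟩

/-- A strategy for `N` bananas is a finite list of actions that can be performed in order, from the
initial situation. -/
def IsStrategy (N : ℕ) (S : List Action) : Prop := AllowedFrom (start N) S

/-- How far the camel penetrates into the desert when it performs `S`, starting with `N` bananas. -/
noncomputable def distance (N : ℕ) (S : List Action) : ℝ := maxPos (start N) S

/-! ### The UWC-strategy

In the following, `a` is the position of the camel, which is with the bananas closest to the origin,
`m` is the position of the banana(s) it has to return to, and `b` is the position of the furthest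
banana. -/

/-- How far one banana can be carried from `a`, if the camel must be able to walk to `m` after
that with one mile in total. -/
noncomputable def evenCarry (a m : ℝ) : ℝ := (1 + m - a) / 2

theorem isGreatest_evenCarry {a m : ℝ} (h : a ≤ m) (h' : m ≤ a + 1) :
    IsGreatest {d : ℝ | |d| + |m - (a + d)| ≤ 1} (evenCarry a m) := by
  unfold evenCarry
  constructor
  · simp only [Set.mem_ofPred_eq]
    rw [abs_of_nonneg (by linarith), abs_of_nonpos (by linarith)]
    linarith
  · intro d hd
    simp only [Set.mem_ofPred_eq] at hd
    have h1 := le_abs_self d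
    have h2 := neg_le_abs (m - (a + d))
    linarith

/-- How far two bananas can be carried from `b`, each in turn, after walking from `a` to `b`,
if the camel must be able to walk to `m` after that with one mile in total. -/
noncomputable def oddCarry (a m b : ℝ) : ℝ := (1 + a + m - 2 * b) / 4

theorem isGreatest_oddCarry {a m b : ℝ} (hab : a ≤ b) (hmb : m ≤ b)
    (h : (b - a) + (b - m) ≤ 1) :
    IsGreatest {d : ℝ | |b - a| + |d| + |-d| + |d| + |m - (b + d)| ≤ 1} (oddCarry a m b) := by
  unfold oddCarry
  constructor
  · simp only [Set.mem_ofPred_eq, abs_neg]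
    rw [abs_of_nonneg (by linarith : (0 : ℝ) ≤ b - a),
      abs_of_nonneg (by linarith : (0 : ℝ) ≤ (1 + a + m - 2 * b) / 4),
      abs_of_nonpos (by linarith)]
    linarith
  · intro d hd
    simp only [Set.mem_ofPred_eq, abs_neg] at hd
    have h0 := le_abs_self (b - a)
    have h1 := le_abs_self d
    have h2 := neg_le_abs (m - (b + d))
    linarith

/-- The same as `oddCarry`, if the camel does not have to return. -/
noncomputable def lastOddCarry (a b : ℝ) : ℝ := (1 + a - b) / 3

theorem isGreatest_lastOddCarry {a b : ℝ} (hab : a ≤ b) (h : b - a ≤ 1) :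
    IsGreatest {d : ℝ | |b - a| + |d| + |-d| + |d| ≤ 1} (lastOddCarry a b) := by
  unfold lastOddCarry
  constructor
  · simp only [Set.mem_ofPred_eq, abs_neg]
    rw [abs_of_nonneg (by linarith : (0 : ℝ) ≤ b - a),
      abs_of_nonneg (by linarith : (0 : ℝ) ≤ (1 + a - b) / 3)]
    linarith
  · intro d hd
    simp only [Set.mem_ofPred_eq, abs_neg] at hd
    have h0 := le_abs_self (b - a)
    have h1 := le_abs_self d
    linarith

/-- Eat a banana, carry another one over a distance `d` and put it down there. -/
def carryOne (d : ℝ) : List Action := [.eat, .pickUp, .walk d, .putDown]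

/-- Eat a banana at `a`, carry another one to the furthest banana at `b`, then carry both bananas,
each in turn, over a distance `d`. -/
def carryTwo (a b d : ℝ) : List Action :=
  [.eat, .pickUp, .walk (b - a), .putDown,
    .pickUp, .walk d, .putDown, .walk (-d), .pickUp, .walk d, .putDown]

/-- One step of the UWC-strategy. The argument is the list of the positions of the bananas that are
left, in increasing order; so if there are at least four, the third entry `m` is the position of
the banana closest to the origin among those that are neither eaten nor carried in this step. If
two or three bananas are left, the camel does not return. -/
noncomputable def uwcStep : List ℝ → List Action
  | [] => []
  | [_] => [.eat, .walk 1]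
  | [_, _] => carryOne 1
  | [a, _, b] => carryTwo a b (lastOddCarry a b)
  | a :: _ :: m :: c :: l =>
    if Even (l.length + 4) then
      carryOne (evenCarry a m) ++ [.walk (m - (a + evenCarry a m))]
    else
      let b := (c :: l).getLast (List.cons_ne_nil c l)
      carryTwo a b (oddCarry a m b) ++ [.walk (m - (b + oddCarry a m b))]

/-- `k` steps of the UWC-strategy, starting in the situation `s`. -/
noncomputable def uwcFrom : ℕ → State → List Action
  | 0, _ => []
  | k + 1, s =>
    let S := uwcStep (s.stock.sort (· ≤ ·))
    S ++ uwcFrom k (run s S)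

/-- The UWC-strategy for `N` bananas: one step for each banana. -/
noncomputable def uwc (N : ℕ) : List Action := uwcFrom N (start N)

/-- `c N` is the distance the UWC-strategy reaches with `N` bananas. -/
noncomputable def c (N : ℕ) : ℝ := distance N (uwc N)

end Camel

open MeasureTheory

namespace Camel


/-! ### The weights -/

/-! Both bounds equal the sum of `weight (i / 2)` over i < N.

Upper bound (`distance_le_sum_weight`). Cut a strategy into legs, each starting with a meal and
hence of length at most 1. Fix a level y with 0 < y ≤ r, where r is the distance reached, and let k
be the number of meals at or beyond y. Bananas cross y one at a time, so y is crossed at least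
max(1, 2k - 1) times. Order the legs by decreasing furthest point, so that those reaching y come
first. Such a leg crosses y at least twice, less one for each of its two ends beyond y; in total at
most k starts and k + 1 ends lie beyond y. Hence, for k ≥ 1, the first 2t legs cross y at least
min(2k - 1, 4t - 1 - 2k) times; k = 0 is treated as k = 1. Since the weights decrease, summation by
parts shows that the weighted number of crossings is least for the extremal sequence `increment k`,
and the recursion for `weight` is what makes that value 1 for every k ≥ 1. Integrating over y bounds
r by the weighted sum of the leg lengths.

Lower bound (`reaches_uwc`). When the bananas lie in pairs, an even step followed by an odd step
leads to pairs again. The distance still attainable is an affine function of the positions,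
`pairsDistance`, and the same recursion shows that such a double step preserves it
(`reaches_uwcFrom_pairs`). -/

/-- The contribution of the bananas number `2 * n + 1` and `2 * n + 2` to the distance. -/
noncomputable def weight : ℕ → ℝ
  | 0 => 1
  -- The value forced by the odd recursion at j = 0, where it reads 4 w(1) = w(0) + w(1).
  | 1 => 1 / 3
  | n + 2 =>
    if h : Even n then weight ((n + 2) / 2) / 2
    else (weight ((n + 2) / 2) + weight ((n + 2) / 2 + 1)) / 4
  decreasing_by
    · omega
    · omega
    · rcases n with _ | n
      · simp at h
      · omega

theorem weight_zero : weight 0 = 1 := by rw [weight]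

theorem weight_one : weight 1 = 1 / 3 := by rw [weight]

theorem weight_two_mul {j : ℕ} (hj : j ≠ 0) : 2 * weight (2 * j) = weight j := by
  obtain ⟨i, rfl⟩ := Nat.exists_eq_succ_of_ne_zero hj
  have h : 2 * i.succ = 2 * i + 2 := by omega
  rw [h, weight, dif_pos (even_two_mul i), show (2 * i + 2) / 2 = i.succ by omega]
  ring

theorem weight_two_mul_add_one (j : ℕ) :
    4 * weight (2 * j + 1) = weight j + weight (j + 1) := by
  rcases j with _ | i
  · norm_num [weight_zero, weight_one]
  · have h : 2 * (i + 1) + 1 = (2 * i + 1) + 2 := by omega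
    rw [h, weight, dif_neg (by simp), show (2 * i + 1 + 2) / 2 = i + 1 by omega]
    ring

theorem weight_nonneg (n : ℕ) : 0 ≤ weight n := by
  induction n using Nat.strong_induction_on with
  | _ n ih =>
    rcases Nat.even_or_odd' n with ⟨j, rfl | rfl⟩
    · rcases Nat.eq_zero_or_pos j with rfl | hj
      · norm_num [weight_zero]
      · have := weight_two_mul hj.ne'
        have := ih j (by omega)
        linarith
    · rcases Nat.eq_zero_or_pos j with rfl | hj
      · norm_num [weight_one]
      · have := weight_two_mul_add_one j
        have := ih j (by omega)
        have := ih (j + 1) (by omega)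
        linarith

theorem weight_antitone : Antitone weight := by
  refine antitone_nat_of_succ_le fun n => ?_
  induction n using Nat.strong_induction_on with
  | _ n ih =>
    rcases Nat.even_or_odd' n with ⟨j, rfl | rfl⟩
    · rcases Nat.eq_zero_or_pos j with rfl | hj
      · norm_num [weight_zero, weight_one]
      · have := weight_two_mul hj.ne'
        have := weight_two_mul_add_one j
        have := ih j (by omega)
        linarith
    · have := weight_two_mul_add_one j
      have := weight_two_mul (j := j + 1) (by omega)
      have := ih j (by omega)
      rw [show 2 * j + 1 + 1 = 2 * (j + 1) by ring]
      linarith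

/-! ### Extremal crossing sequences and summation by parts -/

/-- The increments of the extremal sequence of partial crossing numbers, for a level beyond which
`k` bananas are eaten. -/
def increment (k t : ℕ) : ℤ :=
  if k ≤ t ∨ 2 * t + 1 < k then 0 else if k = 2 * t + 1 then 1 else if k = 2 * t then 3 else 4

/-- The right-hand side is the lower bound for the crossings made by the first 2t legs, which is
what `increment` was designed to sum to. -/
theorem sum_increment {k : ℕ} (hk : 1 ≤ k) (t : ℕ) :
    ∑ i ∈ Finset.range t, increment k i = min (2 * k - 1 : ℤ) (max 0 (4 * t - 1 - 2 * k)) := by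
  induction t with
  | zero => simp; omega
  | succ t ih =>
    rw [Finset.sum_range_succ, ih]
    unfold increment
    split_ifs <;> push_cast <;> omega

/-- Induction on k. From k = 2j to k + 1, the increment drops by 2 at j and gains 4 at 2j; from k =
2j + 1, it drops by 1 at j and at j + 1 and gains 4 at 2j + 1. The two recursions for `weight` say
that these changes cancel. The support lies below k, hence the condition k ≤ n. -/
theorem sum_weight_mul_increment {k n : ℕ} (hk : 1 ≤ k) (hn : k ≤ n) :
    ∑ t ∈ Finset.range n, weight t * increment k t = 1 := by
  induction k, hk using Nat.le_induction with
  | base =>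
    rw [Finset.sum_eq_single 0]
    · simp [increment, weight_zero]
    · intro t _ ht
      rw [increment, if_pos (by omega)]
      simp
    · simp; omega
  | succ k hk ih =>
    rw [← ih (by omega)]
    rcases Nat.even_or_odd' k with ⟨j, rfl | rfl⟩
    · have h : ∀ t, weight t * (increment (2 * j + 1) t : ℝ) = weight t * increment (2 * j) t
          + ((if j = t then weight t * (-2) else 0) + if 2 * j = t then weight t * 4 else 0) := by
        intro t
        have : increment (2 * j + 1) t = increment (2 * j) t
            + ((if j = t then -2 else 0) + if 2 * j = t then 4 else 0) := by
          unfold increment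
          split_ifs <;> omega
        rw [this]
        push_cast
        split_ifs <;> ring
      simp only [h, Finset.sum_add_distrib, Finset.sum_ite_eq, Finset.mem_range]
      rw [if_pos (by omega), if_pos (by omega)]
      have := weight_two_mul (j := j) (by omega)
      linarith
    · have h : ∀ t, weight t * (increment (2 * j + 1 + 1) t : ℝ)
          = weight t * increment (2 * j + 1) t
          + ((if j = t then weight t * (-1) else 0) + (if j + 1 = t then weight t * (-1) else 0)
            + if 2 * j + 1 = t then weight t * 4 else 0) := by
        intro t
        have : increment (2 * j + 1 + 1) t = increment (2 * j + 1) t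
            + ((if j = t then -1 else 0) + (if j + 1 = t then -1 else 0)
              + if 2 * j + 1 = t then 4 else 0) := by
          unfold increment
          split_ifs <;> omega
        rw [this]
        push_cast
        split_ifs <;> ring
      simp only [h, Finset.sum_add_distrib, Finset.sum_ite_eq, Finset.mem_range]
      rw [if_pos (by omega), if_pos (by omega), if_pos (by omega)]
      have := weight_two_mul_add_one j
      linarith

/-- A sequence with larger partial sums has a larger weighted sum. -/
theorem sum_weight_mul_le {f g : ℕ → ℝ}
    (h : ∀ t, ∑ i ∈ Finset.range t, f i ≤ ∑ i ∈ Finset.range t, g i) (n : ℕ) :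
    ∑ t ∈ Finset.range n, weight t * f t ≤ ∑ t ∈ Finset.range n, weight t * g t := by
  -- Keeping the boundary term of the summation by parts makes the induction go through; it is
  -- nonnegative and is dropped at the end.
  suffices weight n * (∑ i ∈ Finset.range n, g i - ∑ i ∈ Finset.range n, f i) ≤
      ∑ t ∈ Finset.range n, weight t * g t - ∑ t ∈ Finset.range n, weight t * f t by
    have := mul_nonneg (weight_nonneg n) (sub_nonneg.2 (h n))
    linarith
  induction n with
  | zero => simp
  | succ n ih =>
    have := mul_le_mul_of_nonneg_right (weight_antitone n.le_succ) (sub_nonneg.2 (h (n + 1)))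
    simp only [Finset.sum_range_succ] at this ⊢
    simp only [Nat.succ_eq_add_one] at this
    linarith

theorem sum_range_two_mul {R : Type*} [AddCommMonoid R] (f : ℕ → R) (n : ℕ) :
    ∑ j ∈ Finset.range (2 * n), f j = ∑ t ∈ Finset.range n, (f (2 * t) + f (2 * t + 1)) := by
  induction n with
  | zero => simp
  | succ n ih =>
    rw [Finset.sum_range_succ, ← ih, show 2 * (n + 1) = 2 * n + 1 + 1 by ring,
      Finset.sum_range_succ, Finset.sum_range_succ, add_assoc]

/-- Here k stands for the number of meals beyond a level and f for the crossings per leg. The first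
alternative occurs when the first 2t legs make all crossings, the second when all of them reach the
level. -/
theorem one_le_sum_weight_mul {k n : ℕ} (hn : k ≤ n) (hn' : 1 ≤ n) {f : ℕ → ℕ}
    (h : ∀ t, 1 ≤ t →
      (1 ≤ ∑ j ∈ Finset.range (2 * t), f j ∧ 2 * k ≤ ∑ j ∈ Finset.range (2 * t), f j + 1) ∨
      4 * t ≤ ∑ j ∈ Finset.range (2 * t), f j + 2 * k + 1) :
    1 ≤ ∑ j ∈ Finset.range (2 * n), weight (j / 2) * f j := by
  -- For k = 0 the hypotheses imply those for k = 1.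
  wlog hk : 1 ≤ k generalizing k
  · refine this hn' (fun t ht => ?_) le_rfl
    have := h t ht
    omega
  rw [← sum_weight_mul_increment hk hn, sum_range_two_mul]
  simp only [show ∀ t, (2 * t + 1) / 2 = t by omega, show ∀ t, 2 * t / 2 = t by omega, ← mul_add]
  refine sum_weight_mul_le (fun t => ?_) n
  have : ∑ i ∈ Finset.range t, increment k i ≤
      ((∑ j ∈ Finset.range (2 * t), f j : ℕ) : ℤ) := by
    rw [sum_increment hk]
    rcases Nat.eq_zero_or_pos t with rfl | ht
    · simp; omega
    · have := h t ht
      omega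
  rw [sum_range_two_mul] at this
  exact_mod_cast this


/-! ### Paths -/

/-- The length of a piecewise straight path, given by the list of its vertices. -/
noncomputable def pathLength : List ℝ → ℝ
  | a :: b :: l => |b - a| + pathLength (b :: l)
  | _ => 0

/-- The indicator function of the positions at or beyond `y`. -/
noncomputable def beyond (y p : ℝ) : ℕ := if y ≤ p then 1 else 0

theorem beyond_of_le {y p : ℝ} (h : y ≤ p) : beyond y p = 1 := if_pos h

theorem beyond_of_lt {y p : ℝ} (h : p < y) : beyond y p = 0 := if_neg (not_le.2 h)

/-- The indicator function of the levels that are crossed on the way from `a` to `b`. -/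
noncomputable def crosses (y a b : ℝ) : ℕ := if a < y ∧ y ≤ b ∨ b < y ∧ y ≤ a then 1 else 0

theorem crosses_self (y a : ℝ) : crosses y a a = 0 :=
  if_neg fun h => h.elim (fun h => absurd h.2 (not_le.2 h.1)) fun h => absurd h.2 (not_le.2 h.1)

/-- If a level is not crossed, then both ends are on the same side of it. -/
theorem crosses_add_beyond (y a b : ℝ) :
    crosses y a b + beyond y a = beyond y b ∧ a < y ∨
      crosses y a b + beyond y b = beyond y a ∧ y ≤ a := by
  unfold crosses beyond
  rcases lt_or_ge a y with ha | ha <;> rcases lt_or_ge b y with hb | hb <;>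
    simp [ha, hb, not_le.2, not_lt.2]

/-- The number of times that a path crosses the level `y`. -/
noncomputable def crossings (y : ℝ) : List ℝ → ℕ
  | a :: b :: l => crosses y a b + crossings y (b :: l)
  | _ => 0

theorem pathLength_nonneg : ∀ l : List ℝ, 0 ≤ pathLength l
  | [] => le_rfl
  | [_] => le_rfl
  | _ :: b :: l => add_nonneg (abs_nonneg _) (pathLength_nonneg (b :: l))

theorem crossings_eq_zero_of_pathLength_eq_zero (y : ℝ) :
    ∀ l : List ℝ, pathLength l = 0 → crossings y l = 0
  | [], _ => rfl
  | [_], _ => rfl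
  | a :: b :: l, h => by
    have h1 := pathLength_nonneg (b :: l)
    rw [pathLength] at h
    have h2 := abs_nonneg (b - a)
    have h3 : b - a = 0 := abs_eq_zero.1 (by linarith)
    obtain rfl : b = a := by linarith
    rw [crossings, crossings_eq_zero_of_pathLength_eq_zero y (b :: l) (by linarith), crosses_self]

theorem exists_le_of_crossings_ne_zero {y : ℝ} :
    ∀ l : List ℝ, crossings y l ≠ 0 → ∃ p ∈ l, y ≤ p
  | [], h => absurd rfl h
  | [_], h => absurd rfl h
  | a :: b :: l, h => by
    by_cases h1 : crossings y (b :: l) = 0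
    · rw [crossings, h1] at h
      have h2 : a < y ∧ y ≤ b ∨ b < y ∧ y ≤ a := by
        by_contra h2
        simp [crosses, h2] at h
      rcases h2 with h2 | h2
      · exact ⟨b, by simp, h2.2⟩
      · exact ⟨a, by simp, h2.2⟩
    · obtain ⟨p, hp, h2⟩ := exists_le_of_crossings_ne_zero (b :: l) h1
      exact ⟨p, List.mem_cons_of_mem _ hp, h2⟩

/-- A path that visits the far side of y has to go there and come back; each end that is already
beyond y saves at most one crossing. -/
theorem le_crossings {y : ℝ} : ∀ l : List ℝ, (∃ p ∈ l, y ≤ p) →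
    2 ≤ crossings y l + beyond y (l.headD 0) + beyond y (l.getLastD 0)
  | [], h => by simp at h
  | [a], h => by
    have : y ≤ a := by simpa using h
    simp [crossings, beyond, this]
  | a :: b :: l, h => by
    by_cases h1 : ∃ p ∈ b :: l, y ≤ p
    · have ih := le_crossings (b :: l) h1
      simp only [List.headD_cons, List.getLastD_cons, crossings] at ih ⊢
      have := crosses_add_beyond y a b
      omega
    · push Not at h1
      have ha : y ≤ a := by
        obtain ⟨p, hp, h2⟩ := h
        rcases List.mem_cons.1 hp with rfl | hp
        · exact h2
        · exact absurd h2 (not_le.2 (h1 p hp))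
      have hb := h1 b (by simp)
      rw [List.headD_cons, crossings, crosses, beyond_of_le ha, if_pos (Or.inr ⟨hb, ha⟩)]
      omega

theorem measurable_crossings : ∀ l : List ℝ, Measurable fun y => (crossings y l : ENNReal)
  | [] => by simp [crossings]
  | [_] => by simp [crossings]
  | a :: b :: l => by
    simp only [crossings, Nat.cast_add]
    refine Measurable.add ?_ (measurable_crossings (b :: l))
    simp only [crosses, Nat.cast_ite, Nat.cast_one, Nat.cast_zero]
    refine Measurable.ite ?_ measurable_const measurable_const
    rw [show {y | a < y ∧ y ≤ b ∨ b < y ∧ y ≤ a} = Set.uIoc a b from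
      Set.ext fun y => Set.mem_uIoc.symm]
    exact measurableSet_uIoc

/-- Each segment contributes the indicator of a half-open interval whose measure is the length of
the segment. -/
theorem lintegral_crossings_le :
    ∀ l : List ℝ, ∫⁻ y, (crossings y l : ENNReal) ≤ ENNReal.ofReal (pathLength l)
  | [] => by simp [crossings]
  | [_] => by simp [crossings]
  | a :: b :: l => by
    simp only [crossings, Nat.cast_add, pathLength]
    rw [lintegral_add_right _ (measurable_crossings (b :: l)),
      ENNReal.ofReal_add (abs_nonneg _) (pathLength_nonneg _)]
    refine add_le_add (le_of_eq ?_) (lintegral_crossings_le (b :: l))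
    rw [← Real.volume_uIoc, ← lintegral_indicator_one measurableSet_uIoc]
    congr 1
    ext y
    by_cases h : y ∈ Set.uIoc a b <;> simp [crosses, h, ← Set.mem_uIoc]

/-! ### Families of paths -/

theorem sum_range_getD {α : Type*} (d : α) (f : α → ℕ) (hf : f d = 0) :
    ∀ (L : List α) (n : ℕ), L.length ≤ n →
      ∑ j ∈ Finset.range n, f (L.getD j d) = (L.map f).sum
  | [], n, _ => by simp [hf]
  | a :: L, n + 1, h => by
    rw [Finset.sum_range_succ']
    simp only [List.getD_cons_succ, List.getD_cons_zero, List.map_cons, List.sum_cons]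
    rw [sum_range_getD d f hf L n (by simpa using h), add_comm]

/-- The number of paths that start at or beyond `y`. -/
noncomputable def startsBeyond (y : ℝ) (L : List (List ℝ)) : ℕ :=
  (L.map fun l => beyond y (l.headD 0)).sum

/-- The number of paths that end at or beyond `y`. -/
noncomputable def endsBeyond (y : ℝ) (L : List (List ℝ)) : ℕ :=
  (L.map fun l => beyond y (l.getLastD 0)).sum

/-- The total number of crossings of the level `y`. -/
noncomputable def totalCrossings (y : ℝ) (L : List (List ℝ)) : ℕ :=
  (L.map (crossings y)).sum

/-- The range exceeds the list so that it covers the support of the extremal increments; the default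
path `[]` has no crossings. -/
theorem one_le_sum_weight_mul_crossings {L : List (List ℝ)}
    (hL : L.Pairwise fun a b => b.maximum ≤ a.maximum) {y : ℝ} (hy : 0 < y)
    (h1 : 1 ≤ totalCrossings y L) (h2 : 2 * startsBeyond y L ≤ totalCrossings y L + 1)
    (h3 : endsBeyond y L ≤ startsBeyond y L + 1) :
    1 ≤ ∑ j ∈ Finset.range (2 * (L.length + startsBeyond y L)),
      weight (j / 2) * crossings y (L.getD j []) := by
  have hlen : 1 ≤ L.length := by
    rcases L with _ | ⟨a, L⟩
    · simp [totalCrossings] at h1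
    · simp
  -- The paths that reach y form an initial segment of the sorted list.
  have hmono : ∀ i j, i ≤ j → (∃ p ∈ L.getD j [], y ≤ p) → ∃ p ∈ L.getD i [], y ≤ p := by
    intro i j hij hj
    rcases hij.eq_or_lt with rfl | hij
    · exact hj
    have hjL : j < L.length := by
      by_contra hjL
      rw [List.getD_eq_default _ _ (not_lt.1 hjL)] at hj
      simp at hj
    rw [List.getD_eq_getElem _ _ hjL] at hj
    rw [List.getD_eq_getElem _ _ (hij.trans hjL)]
    have := List.pairwise_iff_getElem.1 hL i j (hij.trans hjL) hjL hij
    obtain ⟨p, hp, hyp⟩ := hj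
    have h4 : ((y : ℝ) : WithBot ℝ) ≤ L[i].maximum :=
      (WithBot.coe_le_coe.2 hyp).trans ((List.le_maximum_of_mem' hp).trans this)
    obtain ⟨b, hb⟩ : ∃ b : ℝ, L[i].maximum = b :=
      WithBot.ne_bot_iff_exists.1 (fun h => WithBot.not_coe_le_bot y (h ▸ h4)) |>.imp fun _ h => h.symm
    refine ⟨b, List.maximum_mem hb, ?_⟩
    rw [hb] at h4
    exact WithBot.coe_le_coe.1 h4
  have hle : ∀ (f : List ℝ → ℕ), f [] = 0 → ∀ n,
      ∑ j ∈ Finset.range n, f (L.getD j []) ≤ (L.map f).sum := by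
    intro f hf n
    rw [← sum_range_getD [] f hf L (max n L.length) (le_max_right _ _)]
    exact Finset.sum_le_sum_of_subset (Finset.range_mono (le_max_left _ _))
  refine one_le_sum_weight_mul (k := startsBeyond y L) (by omega) (by omega) fun t _ => ?_
  by_cases hc : ∃ j, 2 * t ≤ j ∧ crossings y (L.getD j []) ≠ 0
  -- A later path crosses y, so all of the first 2t paths reach y and `le_crossings` applies to each
  -- of them.
  · right
    obtain ⟨j, hj, hc⟩ := hc
    have h4 : ∑ i ∈ Finset.range (2 * t), 2 ≤ ∑ i ∈ Finset.range (2 * t),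
        (crossings y (L.getD i []) + beyond y ((L.getD i []).headD 0)
          + beyond y ((L.getD i []).getLastD 0)) :=
      Finset.sum_le_sum fun i hi => le_crossings _ <|
        hmono i j (by have := Finset.mem_range.1 hi; omega) (exists_le_of_crossings_ne_zero _ hc)
    rw [Finset.sum_add_distrib, Finset.sum_add_distrib] at h4
    have h5 := hle (fun l => beyond y (l.headD 0)) (beyond_of_lt hy) (2 * t)
    have h6 := hle (fun l => beyond y (l.getLastD 0)) (beyond_of_lt hy) (2 * t)
    simp only [Finset.sum_const, Finset.card_range, smul_eq_mul] at h4
    unfold startsBeyond endsBeyond at *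
    omega
  · left
    push Not at hc
    have : ∑ j ∈ Finset.range (2 * t), crossings y (L.getD j []) = totalCrossings y L := by
      rw [totalCrossings, ← sum_range_getD [] _ rfl L (max (2 * t) L.length) (le_max_right _ _)]
      refine Finset.sum_subset (Finset.range_mono (le_max_left _ _)) fun j _ hj => hc j ?_
      simpa using hj
    rw [this]
    exact ⟨h1, h2⟩

theorem sum_weight_mono {m n : ℕ} (h : m ≤ n) :
    ∑ i ∈ Finset.range m, weight (i / 2) ≤ ∑ i ∈ Finset.range n, weight (i / 2) :=
  Finset.sum_le_sum_of_subset_of_nonneg (Finset.range_mono h) fun _ _ _ => weight_nonneg _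

/-- If each level up to `r` is crossed sufficiently often by paths of length at most one, then `r`
is at most the sum of the weights of the paths. -/
theorem le_sum_weight {L : List (List ℝ)} {r : ℝ} (hlen : ∀ l ∈ L, pathLength l ≤ 1)
    (h : ∀ y, 0 < y → y ≤ r → 1 ≤ totalCrossings y L ∧
      2 * startsBeyond y L ≤ totalCrossings y L + 1 ∧ endsBeyond y L ≤ startsBeyond y L + 1) :
    r ≤ ∑ i ∈ Finset.range L.length, weight (i / 2) := by
  -- Sorting by furthest point changes neither the length of the list nor any of the three counts.
  wlog hL : L.Pairwise fun a b => b.maximum ≤ a.maximum generalizing L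
  · have hperm := List.mergeSort_perm L fun a b => decide (b.maximum ≤ a.maximum)
    have hs := List.pairwise_mergeSort (le := fun a b : List ℝ => decide (b.maximum ≤ a.maximum))
      (fun a b c h1 h2 => by
        simp only [decide_eq_true_eq] at *
        exact h2.trans h1)
      (fun a b => by simpa using le_total _ _) L
    rw [← hperm.length_eq]
    refine this (fun l hl => hlen l (hperm.mem_iff.1 hl)) (fun y h0 hr => ?_) (by simpa using hs)
    have := h y h0 hr
    unfold totalCrossings startsBeyond endsBeyond at *
    rwa [(hperm.map _).sum_eq, (hperm.map _).sum_eq, (hperm.map _).sum_eq]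
  have hpt : ∀ y ∈ Set.Ioc 0 r, (1 : ENNReal) ≤ ∑ j ∈ Finset.range L.length,
      ENNReal.ofReal (weight (j / 2)) * crossings y (L.getD j []) := by
    intro y hy
    obtain ⟨h1, h2, h3⟩ := h y hy.1 hy.2
    have h4 := one_le_sum_weight_mul_crossings hL hy.1 h1 h2 h3
    rw [← Finset.sum_subset (Finset.range_mono (show L.length ≤ _ by omega))] at h4
    · have h5 := ENNReal.ofReal_le_ofReal h4
      rw [ENNReal.ofReal_one, ENNReal.ofReal_sum_of_nonneg fun i _ =>
        mul_nonneg (weight_nonneg _) (Nat.cast_nonneg _)] at h5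
      refine h5.trans (le_of_eq (Finset.sum_congr rfl fun j _ => ?_))
      rw [ENNReal.ofReal_mul (weight_nonneg _), ENNReal.ofReal_natCast]
    · intro j _ hj
      rw [List.getD_eq_default _ _ (by simpa using hj)]
      simp [crossings]
  have hint : ENNReal.ofReal r ≤
      ENNReal.ofReal (∑ i ∈ Finset.range L.length, weight (i / 2)) := by
    calc ENNReal.ofReal r = ∫⁻ _ in Set.Ioc 0 r, 1 := by simp
      _ ≤ ∫⁻ y in Set.Ioc 0 r, ∑ j ∈ Finset.range L.length,
            ENNReal.ofReal (weight (j / 2)) * crossings y (L.getD j []) :=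
          setLIntegral_mono' measurableSet_Ioc hpt
      _ ≤ ∫⁻ y, ∑ j ∈ Finset.range L.length,
            ENNReal.ofReal (weight (j / 2)) * crossings y (L.getD j []) :=
          setLIntegral_le_lintegral _ _
      _ = ∑ j ∈ Finset.range L.length, ENNReal.ofReal (weight (j / 2)) *
            ∫⁻ y, crossings y (L.getD j []) := by
          rw [lintegral_finsetSum _ fun j _ => (measurable_crossings _).const_mul _]
          exact Finset.sum_congr rfl fun j _ => lintegral_const_mul _ (measurable_crossings _)
      _ ≤ ∑ j ∈ Finset.range L.length, ENNReal.ofReal (weight (j / 2)) := by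
          refine Finset.sum_le_sum fun j hj => ?_
          have hj := Finset.mem_range.1 hj
          rw [List.getD_eq_getElem _ _ hj]
          refine mul_le_of_le_one_right' ((lintegral_crossings_le _).trans ?_)
          rw [← ENNReal.ofReal_one]
          exact ENNReal.ofReal_le_ofReal (hlen _ (List.getElem_mem hj))
      _ = _ := (ENNReal.ofReal_sum_of_nonneg fun _ _ => weight_nonneg _).symm
  exact (ENNReal.ofReal_le_ofReal_iff (Finset.sum_nonneg fun _ _ => weight_nonneg _)).1 hint

/-! ### The walks of the camel -/

/-- The path of the camel until the next meal. -/
noncomputable def leg (s : State) : List Action → List ℝ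
  | [] => [s.pos]
  | .walk d :: l => s.pos :: leg (act s (.walk d)) l
  | .pickUp :: l => leg (act s .pickUp) l
  | .putDown :: l => leg (act s .putDown) l
  | .eat :: _ => [s.pos]

/-- The paths of the camel that start with a meal, each until the next meal. -/
noncomputable def legs (s : State) : List Action → List (List ℝ)
  | [] => []
  | .walk d :: l => legs (act s (.walk d)) l
  | .pickUp :: l => legs (act s .pickUp) l
  | .putDown :: l => legs (act s .putDown) l
  | .eat :: l => leg (act s .eat) l :: legs (act s .eat) l

theorem leg_eq_cons (s : State) (l : List Action) : ∃ t, leg s l = s.pos :: t := by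
  induction l generalizing s with
  | nil => exact ⟨[], rfl⟩
  | cons a l ih =>
    cases a with
    | walk d => exact ⟨_, rfl⟩
    | pickUp => exact ih (act s .pickUp)
    | putDown => exact ih (act s .putDown)
    | eat => exact ⟨[], rfl⟩

theorem headD_leg (s : State) (l : List Action) (x : ℝ) : (leg s l).headD x = s.pos := by
  obtain ⟨t, ht⟩ := leg_eq_cons s l
  rw [ht, List.headD_cons]

theorem pathLength_leg_walk (s : State) (d : ℝ) (l : List Action) :
    pathLength (leg s (.walk d :: l)) = |d| + pathLength (leg (act s (.walk d)) l) := by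
  rw [leg]
  obtain ⟨t, ht⟩ := leg_eq_cons (act s (.walk d)) l
  rw [ht, pathLength]
  simp [act]

theorem crossings_leg_walk (y : ℝ) (s : State) (d : ℝ) (l : List Action) :
    crossings y (leg s (.walk d :: l)) =
      crosses y s.pos (s.pos + d) +
        crossings y (leg (act s (.walk d)) l) := by
  rw [leg]
  obtain ⟨t, ht⟩ := leg_eq_cons (act s (.walk d)) l
  rw [ht, crossings]
  simp [act]

theorem pathLength_leg_le {s : State} {l : List Action} (h : AllowedFrom s l)
    (hs : 0 ≤ s.fuel) : pathLength (leg s l) ≤ s.fuel := by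
  induction l generalizing s with
  | nil => simpa [leg, pathLength] using hs
  | cons a l ih =>
    obtain ⟨ha, h⟩ := h
    cases a with
    | walk d =>
      rw [pathLength_leg_walk]
      have h1 : |d| ≤ s.fuel := ha
      have := ih h (by simpa [act] using h1)
      change _ ≤ s.fuel - |d| at this
      linarith
    | pickUp => exact ih h hs
    | putDown => exact ih h hs
    | eat => simpa [leg, pathLength] using hs

theorem pathLength_le_of_mem_legs {s : State} {l : List Action} (h : AllowedFrom s l) :
    ∀ t ∈ legs s l, pathLength t ≤ 1 := by
  induction l generalizing s with
  | nil => simp [legs]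
  | cons a l ih =>
    obtain ⟨ha, h⟩ := h
    cases a with
    | walk d => exact ih h
    | pickUp => exact ih h
    | putDown => exact ih h
    | eat =>
      rw [legs, List.forall_mem_cons]
      exact ⟨pathLength_leg_le h (by simp [act]), ih h⟩

/-- The number of bananas that are at or beyond `y`, including the one on the back. -/
noncomputable def bananasBeyond (y : ℝ) (s : State) : ℕ :=
    (s.stock.map (beyond y)).sum + s.loaded.toNat * beyond y s.pos

theorem length_legs_le {s : State} {l : List Action} (h : AllowedFrom s l) :
    (legs s l).length ≤ s.stock.card + s.loaded.toNat := by
  induction l generalizing s with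
  | nil => simp [legs]
  | cons a l ih =>
    obtain ⟨ha, h⟩ := h
    cases a with
    | walk d => exact ih h
    | pickUp =>
      have := ih h
      have := Multiset.card_erase_add_one ha.2
      have h1 := ha.1
      simp_all [act, legs]
    | putDown =>
      have := ih h
      have h1 : s.loaded = true := ha
      simp_all [act, legs]
    | eat =>
      have h1 := Multiset.card_erase_add_one ha.2
      have := ih h
      simp only [act, legs, List.length_cons] at this ⊢
      omega

theorem sum_map_erase_of_mem {p : ℝ} {m : Multiset ℝ} (h : p ∈ m) (f : ℝ → ℕ) :
    (m.map f).sum = f p + ((m.erase p).map f).sum := by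
  conv_lhs => rw [← Multiset.cons_erase h, Multiset.map_cons, Multiset.sum_cons]

/-- Each banana that is eaten beyond `y` has crossed `y` on the back of the camel. -/
theorem two_mul_startsBeyond_le {s : State} {l : List Action} (h : AllowedFrom s l) (y : ℝ) :
    2 * startsBeyond y (legs s l) ≤ 2 * bananasBeyond y s +
      (crossings y (leg s l) + totalCrossings y (legs s l)) + (1 - beyond y s.pos) := by
  induction l generalizing s with
  | nil => simp [legs, startsBeyond]
  | cons a l ih =>
    obtain ⟨ha, h⟩ := h
    have ih := ih h
    cases a with
    | walk d =>
      -- Crossing y outward with a banana uses one crossing and the term 1 - `beyond`, which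
      -- together pay for the 2 gained from `bananasBeyond`; crossing back restores that term, paid
      -- by the crossing itself.
      have h1 := crosses_add_beyond y s.pos (s.pos + d)
      have h2 : beyond y s.pos ≤ 1 := by unfold beyond; split_ifs <;> simp
      have h3 : beyond y (s.pos + d) ≤ 1 := by unfold beyond; split_ifs <;> simp
      rw [crossings_leg_walk, legs]
      rw [bananasBeyond, show (act s (.walk d)).pos = s.pos + d from rfl,
        show (act s (.walk d)).loaded = s.loaded from rfl,
        show (act s (.walk d)).stock = s.stock from rfl] at ih
      rw [bananasBeyond]
      rcases s.loaded.toNat.eq_zero_or_pos with h4 | h4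
      · rw [h4] at ih ⊢
        omega
      · rw [le_antisymm (Bool.toNat_le _) h4] at ih ⊢
        omega
    | pickUp =>
      have h1 := sum_map_erase_of_mem ha.2 (beyond y)
      have h2 := ha.1
      simp only [bananasBeyond, act, leg, legs, h1, h2, Bool.toNat_true, Bool.toNat_false] at ih ⊢
      omega
    | putDown =>
      have h2 : s.loaded = true := ha
      simp only [bananasBeyond, act, leg, legs, h2, Multiset.map_cons, Multiset.sum_cons,
        Bool.toNat_true, Bool.toNat_false] at ih ⊢
      omega
    | eat =>
      have h1 := sum_map_erase_of_mem ha.2 (beyond y)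
      simp only [startsBeyond, totalCrossings, legs, List.map_cons, List.sum_cons, headD_leg]
        at ih ⊢
      simp only [bananasBeyond, act, leg, h1, crossings] at ih ⊢
      omega

/-- Each leg but the last one ends where the next leg starts. -/
theorem endsBeyond_le (s : State) (l : List Action) (y : ℝ) :
    endsBeyond y (leg s l :: legs s l) ≤ startsBeyond y (legs s l) + 1 := by
  induction l generalizing s with
  | nil =>
    simp only [endsBeyond, legs, List.map_cons, List.map_nil, List.sum_cons, List.sum_nil]
    unfold beyond
    split_ifs <;> omega
  | cons a l ih =>
    cases a with
    | walk d =>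
      have := ih (act s (.walk d))
      obtain ⟨t, ht⟩ := leg_eq_cons (act s (.walk d)) l
      rw [leg, legs]
      rw [ht] at this ⊢
      simpa [endsBeyond] using this
    | pickUp => exact ih _
    | putDown => exact ih _
    | eat =>
      have := ih (act s .eat)
      simp only [endsBeyond, startsBeyond, leg, legs, List.map_cons, List.sum_cons, headD_leg,
        List.getLastD_cons, List.getLastD_nil] at this ⊢
      simp only [act] at this ⊢
      omega

theorem one_le_crossings {y : ℝ} {s : State} {l : List Action} (hs : s.pos < y)
    (h : y ≤ maxPos s l) : 1 ≤ crossings y (leg s l) + totalCrossings y (legs s l) := by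
  induction l generalizing s with
  | nil => exact absurd h (not_le.2 hs)
  | cons a l ih =>
    rw [maxPos, le_max_iff, or_iff_right (not_le.2 hs)] at h
    cases a with
    | walk d =>
      rw [crossings_leg_walk, legs, crosses]
      rcases lt_or_ge (s.pos + d) y with h1 | h1
      · have := ih (s := act s (.walk d)) h1 h
        omega
      · rw [if_pos (Or.inl ⟨hs, h1⟩)]
        omega
    | pickUp => exact ih (s := act s .pickUp) hs h
    | putDown => exact ih (s := act s .putDown) hs h
    | eat =>
      have := ih (s := act s .eat) hs h
      simp only [totalCrossings, leg, legs, List.map_cons, List.sum_cons, crossings] at this ⊢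
      omega

theorem distance_le_sum_weight {N : ℕ} {S : List Action} (h : IsStrategy N S) :
    distance N S ≤ ∑ i ∈ Finset.range N, weight (i / 2) := by
  have hlen := length_legs_le h
  rw [show (start N).stock.card + _ = N by simp [start]] at hlen
  refine le_trans ?_ (sum_weight_mono hlen)
  refine le_sum_weight (pathLength_le_of_mem_legs h) fun y hy hyr => ?_
  -- Before the first meal the stomach is empty, so the camel has not moved.
  have h0 : crossings y (leg (start N) S) = 0 :=
    crossings_eq_zero_of_pathLength_eq_zero y _
      (le_antisymm (pathLength_leg_le h le_rfl) (pathLength_nonneg _))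
  have h1 := one_le_crossings (s := start N) hy hyr
  have h2 := two_mul_startsBeyond_le h y
  have h3 := endsBeyond_le (start N) S y
  have h4 : bananasBeyond y (start N) = 0 := by
    simp [bananasBeyond, start, beyond_of_lt hy]
  rw [h4, h0, beyond_of_lt (show (start N).pos < y from hy)] at h2
  rw [h0] at h1
  change 1 ≤ totalCrossings y (legs (start N) S) ∧ _
  refine ⟨by omega, by omega, le_trans ?_ h3⟩
  simp [endsBeyond]


/-! ### The UWC-strategy -/

/-- The actions are allowed and the camel reaches `r`. -/
def Reaches (s : State) (l : List Action) (r : ℝ) : Prop := AllowedFrom s l ∧ r ≤ maxPos s l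

theorem reaches_append {s : State} {l l' : List Action} {r : ℝ} (h : AllowedFrom s l)
    (h' : Reaches (run s l) l' r) : Reaches s (l ++ l') r := by
  induction l generalizing s with
  | nil => exact h'
  | cons a l ih =>
    have := ih h.2 h'
    exact ⟨⟨h.1, this.1⟩, this.2.trans (le_max_right _ _)⟩

/-- The first `k` steps of the UWC-strategy obey the rules, and the camel reaches `r`. -/
def UwcReaches (k : ℕ) (s : State) (r : ℝ) : Prop := Reaches s (uwcFrom k s) r

/-- The actions are allowed and lead to the situation `s'`. -/
def Leads (s : State) (l : List Action) (s' : State) : Prop := AllowedFrom s l ∧ run s l = s'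

theorem sort_coe_of_pairwise {L : List ℝ} (hL : L.Pairwise (· ≤ ·)) :
    (L : Multiset ℝ).sort (· ≤ ·) = L :=
  List.Perm.eq_of_pairwise' (Multiset.pairwise_sort _ _) hL
    (Multiset.coe_eq_coe.1 (Multiset.sort_eq _ _))

theorem reaches_uwcFrom_succ {s s' : State} {L : List ℝ} (hs : s.stock = L)
    (hL : L.Pairwise (· ≤ ·)) (h : Leads s (uwcStep L) s') {k : ℕ} {r : ℝ}
    (h' : UwcReaches k s' r) : UwcReaches (k + 1) s r := by
  rw [UwcReaches, uwcFrom, hs, sort_coe_of_pairwise hL]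
  exact reaches_append h.1 (by rwa [h.2])

theorem leads_carryOne {a d : ℝ} {R : Multiset ℝ} (hd : |d| ≤ 1) :
    Leads ⟨a, 0, false, a ::ₘ a ::ₘ R⟩ (carryOne d) ⟨a + d, 1 - |d|, false, (a + d) ::ₘ R⟩ := by
  simp [Leads, carryOne, AllowedFrom, Allowed, run, act, hd]

theorem leads_carryOne_walk {a m d : ℝ} {R : Multiset ℝ} (hd : |d| + |m - (a + d)| = 1) :
    Leads ⟨a, 0, false, a ::ₘ a ::ₘ R⟩ (carryOne d ++ [.walk (m - (a + d))])
      ⟨m, 0, false, (a + d) ::ₘ R⟩ := by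
  have h1 : |d| ≤ 1 := by linarith [abs_nonneg (m - (a + d))]
  have h2 : |m - (a + d)| = 1 - |d| := by linarith
  simp [Leads, carryOne, AllowedFrom, Allowed, run, act, h1, h2]

theorem leads_carryTwo {a b d : ℝ} {R : Multiset ℝ} (hd : |b - a| + 3 * |d| ≤ 1) :
    Leads ⟨a, 0, false, a ::ₘ a ::ₘ b ::ₘ R⟩ (carryTwo a b d)
      ⟨b + d, 1 - (|b - a| + 3 * |d|), false, (b + d) ::ₘ (b + d) ::ₘ R⟩ := by
  have h0 := abs_nonneg d
  have h1 : |b - a| ≤ 1 := by linarith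
  have h2 : |d| ≤ 1 - |b - a| := by linarith
  have h3 : |d| ≤ 1 - |b - a| - |d| := by linarith
  have h4 : |d| ≤ 1 - |b - a| - |d| - |d| := by linarith
  have h5 : (b + d) ::ₘ b ::ₘ R = b ::ₘ (b + d) ::ₘ R := Multiset.cons_swap _ _ _
  simp [Leads, carryTwo, AllowedFrom, Allowed, run, act, h1, h2, h3, h4, h5]
  ring

theorem leads_carryTwo_walk {a b m d : ℝ} {R : Multiset ℝ}
    (hd : |b - a| + 3 * |d| + |m - (b + d)| = 1) :
    Leads ⟨a, 0, false, a ::ₘ a ::ₘ b ::ₘ R⟩ (carryTwo a b d ++ [.walk (m - (b + d))])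
      ⟨m, 0, false, (b + d) ::ₘ (b + d) ::ₘ R⟩ := by
  have h0 := abs_nonneg d
  have h1 : |b - a| ≤ 1 := by linarith [abs_nonneg (m - (b + d))]
  have h2 : |d| ≤ 1 - |b - a| := by linarith [abs_nonneg (m - (b + d))]
  have h3 : |d| ≤ 1 - |b - a| - |d| := by linarith [abs_nonneg (m - (b + d))]
  have h4 : |d| ≤ 1 - |b - a| - |d| - |d| := by linarith [abs_nonneg (m - (b + d))]
  have h5 : (b + d) ::ₘ b ::ₘ R = b ::ₘ (b + d) ::ₘ R := Multiset.cons_swap _ _ _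
  have h6 : |m - (b + d)| = 1 - |b - a| - |d| - |d| - |d| := by linarith
  simp [Leads, carryTwo, AllowedFrom, Allowed, run, act, h1, h2, h3, h4, h5, h6]

/-! ### Bananas lying in pairs -/

/-- The list in which each element is repeated. -/
def pairs : List ℝ → List ℝ
  | [] => []
  | a :: l => a :: a :: pairs l

theorem mem_pairs {p : ℝ} {l : List ℝ} : p ∈ pairs l ↔ p ∈ l := by
  induction l with
  | nil => rfl
  | cons a l ih => simp [pairs, ih]

theorem pairs_append_singleton (l : List ℝ) (w : ℝ) : pairs (l ++ [w]) = pairs l ++ [w, w] := by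
  induction l with
  | nil => rfl
  | cons a l ih => simp [pairs, ih]

theorem length_pairs (l : List ℝ) : (pairs l).length = 2 * l.length := by
  induction l with
  | nil => rfl
  | cons a l ih => simp [pairs, ih]; ring

theorem pairwise_pairs {l : List ℝ} (h : l.Pairwise (· ≤ ·)) : (pairs l).Pairwise (· ≤ ·) := by
  induction l with
  | nil => exact List.Pairwise.nil
  | cons a l ih =>
    rw [List.pairwise_cons] at h
    simp only [pairs, List.pairwise_cons, List.mem_cons, forall_eq_or_imp, mem_pairs]
    exact ⟨⟨le_rfl, h.1⟩, h.1, ih h.2⟩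

theorem pairs_replicate (n : ℕ) (x : ℝ) :
    pairs (List.replicate n x) = List.replicate (2 * n) x := by
  induction n with
  | zero => rfl
  | succ n ih => rw [List.replicate_succ, pairs, ih]; rfl

/-- What bananas at the positions in `l` contribute to the distance, if the `i`-th position from
the end has weight `4 * weight (m + i)`. -/
noncomputable def weightedSum (m : ℕ) : List ℝ → ℝ
  | [] => 0
  | a :: l => 4 * weight (m + l.length) * a + weightedSum m l

theorem weightedSum_append_singleton (m : ℕ) (l : List ℝ) (w : ℝ) :
    weightedSum m (l ++ [w]) = weightedSum (m + 1) l + 4 * weight m * w := by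
  induction l with
  | nil => simp [weightedSum]
  | cons a l ih =>
    rw [List.cons_append, weightedSum, ih, weightedSum, List.length_append, List.length_singleton,
      show m + (l.length + 1) = m + 1 + l.length by ring]
    ring

theorem weightedSum_replicate_zero (m n : ℕ) : weightedSum m (List.replicate n 0) = 0 := by
  induction n with
  | zero => rfl
  | succ n ih => rw [List.replicate_succ, weightedSum, ih]; ring

/-- The distance that the UWC-strategy reaches from the situation in which there are two bananas at
each of the positions in the list. -/
noncomputable def pairsDistance : List ℝ → ℝ
  | [] => 0
  | a :: l => 2 * ∑ t ∈ Finset.range (l.length + 1), weight t + weight l.length * a +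
      weightedSum (l.length + 1) l

theorem reaches_uwcFrom_one (a : ℝ) :
    UwcReaches 1 ⟨a, 0, false, {a}⟩ (a + 1) := by
  simp [UwcReaches, Reaches, uwcFrom, uwcStep, AllowedFrom, Allowed, act, maxPos]

theorem reaches_uwcFrom_two (a : ℝ) :
    UwcReaches 2 ⟨a, 0, false, {a, a}⟩ (a + 2) := by
  refine reaches_uwcFrom_succ (L := [a, a]) rfl (by simp) (s' := ⟨a + 1, 0, false, {a + 1}⟩) ?_ ?_
  · have := leads_carryOne (a := a) (d := 1) (R := 0) (by simp)
    simpa [uwcStep] using this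
  · convert reaches_uwcFrom_one (a + 1) using 1
    ring

theorem reaches_uwcFrom_three {a b : ℝ} (hab : a ≤ b) (h : b ≤ a + 1) :
    UwcReaches 3 ⟨a, 0, false, {a, a, b}⟩ ((1 + a + 2 * b) / 3 + 2) := by
  have hd : |b - a| + 3 * |lastOddCarry a b| = 1 := by
    rw [lastOddCarry, abs_of_nonneg (by linarith), abs_of_nonneg (by linarith)]
    ring
  refine reaches_uwcFrom_succ (L := [a, a, b]) rfl (by simp [hab]) (leads_carryTwo hd.le) ?_
  rw [hd, sub_self]
  convert reaches_uwcFrom_two (b + lastOddCarry a b) using 1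
  · rfl
  · rw [lastOddCarry]
    ring

theorem leads_uwcStep_even {a m : ℝ} {l : List ℝ} (ham : a ≤ m) (hma : m ≤ a + 1)
    (hl : Even l.length) :
    Leads ⟨a, 0, false, ↑(a :: a :: m :: m :: l)⟩ (uwcStep (a :: a :: m :: m :: l))
      ⟨m, 0, false, ↑(m :: m :: l ++ [(1 + a + m) / 2])⟩ := by
  rw [uwcStep, if_pos (by simpa [Nat.even_add, show Even 4 by decide] using hl)]
  have h := leads_carryOne_walk (a := a) (m := m) (d := evenCarry a m) (R := ↑(m :: m :: l)) (by
    rw [evenCarry, abs_of_nonneg (by linarith), abs_of_nonpos (by linarith)]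
    ring)
  convert h using 1
  · rfl
  · rw [show a + evenCarry a m = (1 + a + m) / 2 by rw [evenCarry]; ring, Multiset.cons_coe]
    exact congrArg _ (Multiset.coe_eq_coe.2 (List.perm_append_singleton _ _))

theorem leads_uwcStep_odd {a b m : ℝ} {l : List ℝ} (hab : a ≤ b) (hmb : m ≤ b)
    (h : 2 * b ≤ 1 + a + m) (hl : Even l.length) :
    Leads ⟨a, 0, false, ↑(a :: a :: m :: m :: l ++ [b])⟩ (uwcStep (a :: a :: m :: m :: l ++ [b]))
      ⟨m, 0, false,
        ↑(m :: m :: l ++ [(1 + a + m + 2 * b) / 4, (1 + a + m + 2 * b) / 4])⟩ := by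
  simp only [List.cons_append]
  rw [uwcStep, if_neg (by simpa [Nat.even_add, Nat.even_add_one] using hl)]
  have hb : (m :: (l ++ [b])).getLast (List.cons_ne_nil _ _) = b := by
    rw [List.getLast_cons (by simp), List.getLast_append_singleton]
  simp only [hb]
  have h := leads_carryTwo_walk (a := a) (b := b) (m := m) (d := oddCarry a m b)
    (R := ↑(m :: m :: l)) (by
      rw [oddCarry, abs_of_nonneg (by linarith), abs_of_nonneg (by linarith),
        abs_of_nonpos (by linarith)]
      ring)
  convert h using 1
  · refine congrArg _ ?_
    simp only [Multiset.cons_coe, Multiset.coe_eq_coe, List.perm_cons]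
    exact List.perm_append_singleton b (m :: m :: l)
  · rw [show b + oddCarry a m b = (1 + a + m + 2 * b) / 4 by rw [oddCarry]; ring]
    refine congrArg _ ?_
    simp only [Multiset.cons_coe, Multiset.coe_eq_coe]
    exact List.perm_append_comm (l₁ := m :: m :: l) (l₂ := [_, _])

/-- Induction over double steps. The hypothesis `h` says that one mile suffices to walk from a to
any later position p and back to the next pair. So the even step drops its banana at or beyond all
the others, which keeps the list sorted, and the condition is inherited by the new list. -/
theorem reaches_uwcFrom_pairs {n : ℕ} {a : ℝ} {l : List ℝ} (hn : l.length = n)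
    (hs : (a :: l).Pairwise (· ≤ ·)) (h : ∀ p ∈ l, 2 * p ≤ 1 + a + l.headD 0) :
    UwcReaches (2 * (n + 1)) ⟨a, 0, false, ↑(pairs (a :: l))⟩ (pairsDistance (a :: l)) := by
  induction n generalizing a l with
  | zero =>
    obtain rfl := List.length_eq_zero_iff.1 hn
    convert reaches_uwcFrom_two a using 1
    · rfl
    · norm_num [pairsDistance, weightedSum, weight_zero]
      ring
  | succ n ih =>
    rcases l with _ | ⟨b, _ | ⟨m, l⟩⟩
    · simp at hn
    -- With two pairs, the even step leaves three bananas, and the odd step after it has no return;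
    -- hence the separate case.
    · obtain rfl : n = 0 := by simpa using hn.symm
      simp only [List.pairwise_cons, List.mem_singleton, forall_eq] at hs
      simp only [List.mem_singleton, forall_eq, List.headD_cons] at h
      have hb : b ≤ (1 + a + b) / 2 := by linarith
      refine reaches_uwcFrom_succ rfl (pairwise_pairs (l := [a, b]) (by simp [hs]))
        (leads_uwcStep_even (l := []) hs.1 (by linarith) (by simp)) ?_
      convert reaches_uwcFrom_three hb (by linarith) using 1
      · rfl
      · have h2 : 2 * weight 2 = weight 1 := weight_two_mul one_ne_zero
        rw [weight_one] at h2
        simp only [pairsDistance, weightedSum, Finset.sum_range_succ, List.length_cons,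
          List.length_nil, Finset.sum_range_zero, weight_zero, weight_one, zero_add, add_zero,
          Nat.reduceAdd]
        linear_combination 2 * b * h2
    · have hs0 := hs
      have hn : l.length + 1 = n := by simpa using hn
      simp only [List.pairwise_cons, List.mem_cons, forall_eq_or_imp] at hs
      simp only [List.mem_cons, forall_eq_or_imp, List.headD_cons] at h
      obtain ⟨⟨hab, ham, hal⟩, ⟨hbm, hbl⟩, hml, hl⟩ := hs
      obtain ⟨h1, h2, h3⟩ := h
      -- z is where the even step puts its banana; w is where the odd step puts that banana together
      -- with a second one.
      set z := (1 + a + b) / 2 with hz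
      set w := (1 + b + m + 2 * z) / 4 with hw
      have hev : Even (pairs l).length := by rw [length_pairs]; exact even_two_mul _
      have hzw : z ≤ w := by rw [hw, hz]; linarith
      refine reaches_uwcFrom_succ rfl (pairwise_pairs hs0)
        (leads_uwcStep_even (l := m :: m :: pairs l) hab (by linarith)
          (by simpa [Nat.even_add_one] using hev)) ?_
      refine reaches_uwcFrom_succ (L := b :: b :: m :: m :: pairs l ++ [z]) rfl ?_
        (leads_uwcStep_odd (by linarith) (by linarith) (by linarith) hev) ?_
      · rw [List.pairwise_append]
        refine ⟨pairwise_pairs (l := b :: m :: l) (List.pairwise_cons.1 hs0).2, by simp, ?_⟩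
        intro p hp q hq
        rw [List.mem_singleton.1 hq]
        rcases List.mem_cons.1 (mem_pairs (l := b :: m :: l).1 hp) with rfl | hp
        · linarith
        · rcases List.mem_cons.1 hp with rfl | hp
          · linarith
          · linarith [h3 p hp]
      · have key := ih (a := m) (l := l ++ [w]) (by simpa using hn) (by
          simp only [List.pairwise_cons, List.pairwise_append, List.mem_append, List.mem_singleton]
          refine ⟨?_, hl, by simp, ?_⟩
          · rintro p (hp | rfl)
            · exact hml p hp
            · linarith
          · rintro p hp q rfl
            linarith [h3 p hp]) (by
          have hhead : m ≤ (l ++ [w]).headD 0 ∧ (l = [] → (l ++ [w]).headD 0 = w) := by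
            rcases l with _ | ⟨c, l⟩
            · exact ⟨by simp; linarith, fun _ => rfl⟩
            · exact ⟨hml c (by simp), by simp⟩
          have hwle : 2 * w ≤ 1 + m + (l ++ [w]).headD 0 := by
            rw [hw, hz]; linarith [hhead.1]
          intro p hp
          rw [List.mem_append, List.mem_singleton] at hp
          rcases hp with hp | rfl
          · linarith [h3 p hp]
          · exact hwle)
        convert key using 1
        · rfl
        · simp only [pairs, pairs_append_singleton, List.cons_append, hw]
        · subst hn
          have e1 := weight_two_mul (j := l.length + 2) (by omega)
          have e2 := weight_two_mul_add_one (l.length + 1)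
          simp only [pairsDistance, weightedSum, List.length_cons, List.length_append,
            List.length_nil, weightedSum_append_singleton, zero_add]
          rw [Finset.sum_range_succ _ (l.length + 1 + 1),
            show l.length + 1 + 1 + 1 + (l.length + 1) = 2 * (l.length + 2) by ring,
            show l.length + 1 + 1 + 1 + l.length = 2 * (l.length + 1) + 1 by ring]
          simp only [show l.length + 1 + 1 = l.length + 2 by ring] at e2 ⊢
          rw [hw, hz]
          -- Since 4w = 2 + a + 2b + m, the new pair at w, with coefficient 4 `weight (l.length +
          -- 2)`, returns the missing constant and the old coefficient of a. Comparing the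
          -- coefficients of b and of m gives exactly the even and the odd recursion.
          linear_combination 2 * b * e1 + m * e2

theorem reaches_uwc (N : ℕ) :
    Reaches (start N) (uwc N) (∑ i ∈ Finset.range N, weight (i / 2)) := by
  change UwcReaches N ⟨0, 0, false, Multiset.replicate N 0⟩ _
  have hsum : ∀ n, ∑ i ∈ Finset.range (2 * n), weight (i / 2)
      = 2 * ∑ t ∈ Finset.range n, weight t := by
    intro n
    rw [sum_range_two_mul, Finset.mul_sum]
    refine Finset.sum_congr rfl fun t _ => ?_
    rw [show 2 * t / 2 = t by omega, show (2 * t + 1) / 2 = t by omega]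
    ring
  rcases Nat.even_or_odd' N with ⟨n, rfl | rfl⟩
  · rw [hsum]
    rcases n with _ | n
    · simp [UwcReaches, Reaches, uwcFrom, AllowedFrom, maxPos]
    · have := reaches_uwcFrom_pairs (n := n) (a := 0) (l := List.replicate n 0) (by simp)
        (by simp [List.pairwise_replicate]) (by
          intro p hp
          obtain rfl := List.eq_of_mem_replicate hp
          rcases n with _ | n <;> simp [List.replicate_succ])
      rw [← List.replicate_succ, pairs_replicate, Multiset.coe_replicate] at this
      convert this using 1
      rw [List.replicate_succ, pairsDistance, weightedSum_replicate_zero, List.length_replicate]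
      ring
  · rw [Finset.sum_range_succ, hsum, show 2 * n / 2 = n by omega]
    rcases n with _ | _ | n
    · convert reaches_uwcFrom_one 0 using 1
      · rfl
      · simp [weight_zero]
    · convert reaches_uwcFrom_three (a := 0) (b := 0) le_rfl (by simp) using 1
      · rfl
      · norm_num [weight_zero, weight_one]
    · have hrep : 0 :: 0 :: 0 :: 0 :: List.replicate (2 * n) (0 : ℝ) ++ [0] =
          List.replicate (2 * (n + 1 + 1) + 1) 0 := by
        rw [List.replicate_succ', show 2 * (n + 1 + 1) = 2 * n + 1 + 1 + 1 + 1 by ring]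
        rfl
      -- One odd step from the origin moves two bananas to 1/4 and leaves the rest in pairs. The
      -- pair at 1/4 has coefficient 4 `weight (n + 2)`, which yields the weight of the unpaired
      -- banana.
      have hstep := leads_uwcStep_odd (a := 0) (b := 0) (m := 0) (l := List.replicate (2 * n) 0)
        le_rfl le_rfl (by simp) (by simp)
      rw [hrep, Multiset.coe_replicate] at hstep
      refine reaches_uwcFrom_succ (Multiset.coe_replicate _ _).symm
        (by simp [List.pairwise_replicate]) hstep ?_
      have key := reaches_uwcFrom_pairs (n := n + 1) (a := 0) (l := List.replicate n 0 ++ [1 / 4])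
        (by simp) (by
          simp only [List.pairwise_cons, List.pairwise_append, List.mem_append,
            List.mem_singleton, List.mem_replicate]
          refine ⟨?_, by simp [List.pairwise_replicate], by simp, ?_⟩
          · rintro p (⟨_, rfl⟩ | rfl) <;> norm_num
          · rintro p ⟨_, rfl⟩ q rfl
            norm_num) (by
          intro p hp
          have h0 : 0 ≤ (List.replicate n (0 : ℝ) ++ [1 / 4]).headD 0 := by
            rcases n with _ | n <;> simp [List.replicate_succ]
          have hp : p ≤ 1 / 4 := by
            simp only [List.mem_append, List.mem_singleton, List.mem_replicate] at hp
            rcases hp with ⟨_, rfl⟩ | rfl <;> norm_num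
          linarith)
      convert key using 1
      · norm_num [pairs, pairs_append_singleton, pairs_replicate]
      · rw [pairsDistance, weightedSum_append_singleton, weightedSum_replicate_zero]
        simp only [List.length_append, List.length_replicate, List.length_singleton]
        ring

end Camel

theorem mainTheorem1 (N : ℕ) :
    Camel.IsStrategy N (Camel.uwc N) ∧
      ∀ S : List Camel.Action, Camel.IsStrategy N S → Camel.distance N S ≤ Camel.c N :=
  ⟨(Camel.reaches_uwc N).1, fun _ hS =>
    (Camel.distance_le_sum_weight hS).trans (Camel.reaches_uwc N).2⟩
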